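/- Let $(M,d)$ be a locally compact metric space with a Radon measure $\mu$ of full support on its Borel $\sigma$-algebra. Write $B(x,r)=\{y\in M: d(x,y)\le r\}$ and $V(x,r)=\mu(B(x,r))$. Fix $b>0$ and $h'\ge h>0$, and assume the following. 1. $(M,d)$ is quasi-$b$-geodesic: there is $C>0$ with $d_b(x,y)\le C\,d(x,y)$ for all $x,y\in M$, where $d_b(x,y)\in[0,\infty]$ is the infimum of $\sum_{i<m}d(x_i,x_{i+1})$ over all finite sequences $x=x_0,x_1,\dots,x_m=y$ in $M$ with $d(x_i,x_{i+1})\le b$ for all $i<m$. 2. $(VD)_{\rm loc}$: for every $r>0$ there is $C_r$ with $V(x,2r)\le C_rV(x,r)$ for all $x\in M$. 3. $(VD)_\infty$: there are $r_0,C_{r_0}>0$ with $V(x,2r)\le C_{r_0}V(x,r)$ for all $x\in M$ and all $r\ge r_0$. 4. The Poincaré inequality $(P)_h$ at scale $h$: there are $C_1>0$, $C_2\ge1$, $r_0>0$ such that for all $f\in L^\infty_{\rm loc}(M,\mu)$, $x\in M$ and $r\ge r_0$, $$\int_{B(x,r)}|f-f_{B(x,r)}|^2\,d\mu\le C_1r^2\int_{B(x,C_2r)}|\nabla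 f|_h^2\,d\mu ,$$ where $f_{B(x,r)}$ is the $\mu$-average of $f$ over $B(x,r)$ and $|\nabla f|_h(y)=\Big(\frac1{V(y,h)}\int_{B(y,h)}|f(z)-f(y)|^2\,\mu(dz)\Big)^{1/2}$. 5. $\mathcal P$ is a Markov transition function on $M$ with an $(h,h')$-compatible kernel $p$, that is: (a) $\mathcal P$ is $\mu$-symmetric: $\iint u_1(x)u_2(y)\,\mathcal P(x,dy)\,\mu(dx)=\iint u_2(x)u_1(y)\,\mathcal P(x,dy)\,\mu(dx)$ for all measurable $u_1,u_2:M\to[0,\infty)$; (b) $p:M\times M\to[0,\infty)$ satisfies $\mathcal P(x,A)=\int_Ap(x,y)\,\mu(dy)$ for all $x\in M$ and all Borel sets $A$; (c) there are $c_1,C_1>0$ such that for all $x\in M$ and $\mu$-almost every $y\in M$, $\frac{c_1}{V(x,h)}\mathbf 1_{B(x,h)}(y)\le p(x,y)\le\frac{C_1}{V(x,h')}\mathbf 1_{B(x,h')}(y)$; (d) there is $\alpha>0$ such that for all $x\in M$ and $\mu$-almost every $y\in M$, $\int_Mp(x,z)p(y,z)\,\mu(dz)\ge\alpha\,p(x,y)$.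 For a ball $B$ and $f\in L^2(B)=L^2(B,\mu|_B)$ put $P_Bf(x)=\int_Bp(x,y)f(y)\,\mu(dy)$ for $x\in B$ and $\mathcal E^B(f,f)=\langle f,(I-P_B)f\rangle_{L^2(B)}$. Then there exist $\delta>2$ and $C_S>0$ such that for all $r>0$, all $x\in M$ and all $f\in L^2(B)$ with $B=B(x,r)$, we have $P_Bf\in L^{2\delta/(\delta-2)}(B)$ and $$\|P_Bf\|_{2\delta/(\delta-2)}^2\le\frac{C_S\,r^2}{V(x,r)^{2/\delta}}\left(\mathcal E^B(f,f)+r^{-2}\|f\|_2^2\right),$$ the norms being those of $L^{2\delta/(\delta-2)}(B)$ and $L^2(B)$. -/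

import Mathlib

open MeasureTheory ProbabilityTheory Metric
open scoped ENNReal NNReal

noncomputable section

section MetricGeometry

variable {M : Type*} [MetricSpace M]

/-- A finite sequence `γ 0, …, γ m` is a `b`-chain from `x` to `y`: it starts at `x`, ends at `y`
and consecutive points are at distance at most `b`. -/
def IsChainFromTo (b : ℝ) (x y : M) (m : ℕ) (γ : Fin (m + 1) → M) : Prop :=
  γ 0 = x ∧ γ (Fin.last m) = y ∧ ∀ i : Fin m, dist (γ i.castSucc) (γ i.succ) ≤ b

/-- The length of a chain. -/
def chainLength {m : ℕ} (γ : Fin (m + 1) → M) : ℝ≥0∞ :=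
  ∑ i : Fin m, edist (γ i.castSucc) (γ i.succ)

/-- The `[0, ∞]`-valued distance `d_b`: the infimum of the lengths of the `b`-chains from `x` to
`y` (it is `∞` if there is no such chain). -/
def chainDist (b : ℝ) (x y : M) : ℝ≥0∞ :=
  ⨅ (m : ℕ) (γ : Fin (m + 1) → M) (_ : IsChainFromTo b x y m γ), chainLength γ

/-- `M` is quasi-`b`-geodesic: `d_b ≤ C d` for some constant `C > 0`. -/
def IsQuasiGeodesic (M : Type*) [MetricSpace M] (b : ℝ) : Prop :=
  ∃ C : ℝ, 0 < C ∧ ∀ x y : M, chainDist b x y ≤ ENNReal.ofReal (C * dist x y)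

end MetricGeometry

section MetricMeasure

variable {M : Type*} [MetricSpace M] [MeasurableSpace M]

/-- Local volume doubling. -/
def VolumeDoublingLoc (μ : Measure M) : Prop :=
  ∀ r : ℝ, 0 < r → ∃ C : ℝ≥0, ∀ x : M,
    μ (closedBall x (2 * r)) ≤ C * μ (closedBall x r)

/-- Large scale volume doubling. -/
def VolumeDoublingInfty (μ : Measure M) : Prop :=
  ∃ (r₀ : ℝ) (C : ℝ≥0), 0 < r₀ ∧ 0 < C ∧ ∀ (x : M) (r : ℝ), r₀ ≤ r →
    μ (closedBall x (2 * r)) ≤ C * μ (closedBall x r)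

/-- `f` belongs to `L^∞_loc(M, μ)`: it is measurable up to a null set and essentially bounded on
every compact set. -/
def MemLinftyLoc (μ : Measure M) (f : M → ℝ) : Prop :=
  AEStronglyMeasurable f μ ∧ ∀ K : Set M, IsCompact K → MemLp f ∞ (μ.restrict K)

/-- The length of the gradient of `f` at scale `h`,
`|∇f|_h (x) = (V(x,h)⁻¹ ∫_{B(x,h)} |f(y) - f(x)|² μ(dy))^{1/2}`. -/
def gradLength (μ : Measure M) (h : ℝ) (f : M → ℝ) (x : M) : ℝ≥0∞ :=
  ((∫⁻ y in closedBall x h, ‖f y - f x‖ₑ ^ 2 ∂μ) / μ (closedBall x h)) ^ (1 / 2 : ℝ)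

/-- The Poincaré inequality at scale `h`. -/
def PoincareAtScale (μ : Measure M) (h : ℝ) : Prop :=
  ∃ (C₁ : ℝ≥0) (C₂ r₀ : ℝ), 0 < C₁ ∧ 1 ≤ C₂ ∧ 0 < r₀ ∧
    ∀ f : M → ℝ, MemLinftyLoc μ f → ∀ (x : M) (r : ℝ), r₀ ≤ r →
      ∫⁻ y in closedBall x r, ‖f y - ⨍ z in closedBall x r, f z ∂μ‖ₑ ^ 2 ∂μ ≤
        C₁ * ENNReal.ofReal (r ^ 2) *
          ∫⁻ y in closedBall x (C₂ * r), gradLength μ h f y ^ 2 ∂μ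

/-- The transition function `κ` is `μ`-symmetric:
`∬ u₁(x) u₂(y) κ(x,dy) μ(dx) = ∬ u₂(x) u₁(y) κ(x,dy) μ(dx)` for all measurable
`u₁, u₂ : M → [0, ∞)`. -/
def IsSymmetricTransition (μ : Measure M) (κ : Kernel M M) : Prop :=
  ∀ u₁ u₂ : M → ℝ≥0, Measurable u₁ → Measurable u₂ →
    ∫⁻ x, ∫⁻ y, (u₁ x : ℝ≥0∞) * u₂ y ∂(κ x) ∂μ = ∫⁻ x, ∫⁻ y, (u₂ x : ℝ≥0∞) * u₁ y ∂(κ x) ∂μ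

/-- The second iterate `p₂(x,y) = ∫ p(x,z) p(y,z) μ(dz)` of a kernel `p`. -/
def secondKernel (μ : Measure M) (p : M → M → ℝ≥0) (x y : M) : ℝ≥0∞ :=
  ∫⁻ z, (p x z : ℝ≥0∞) * p y z ∂μ

/-- The Markov transition function `κ` has a kernel `p` with respect to `μ`, and is
`(h, h')`-compatible with the metric measure space `(M, d, μ)`. -/
structure IsCompatible (μ : Measure M) (h h' : ℝ) (κ : Kernel M M) (p : M → M → ℝ≥0) : Prop where
  scale_pos : 0 < h
  scale_le : h ≤ h'
  isMarkov : IsMarkovKernel κ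
  symmetric : IsSymmetricTransition μ κ
  measurable_kernel : ∀ x : M, Measurable (p x)
  density : ∀ (x : M) (A : Set M), MeasurableSet A → κ x A = ∫⁻ y in A, (p x y : ℝ≥0∞) ∂μ
  two_sided : ∃ c₁ C₁ : ℝ≥0, 0 < c₁ ∧ 0 < C₁ ∧ ∀ x : M, ∀ᵐ y ∂μ,
    (closedBall x h).indicator (fun _ => (c₁ : ℝ≥0∞) / μ (closedBall x h)) y ≤ p x y ∧
    (p x y : ℝ≥0∞) ≤ (closedBall x h').indicator (fun _ => (C₁ : ℝ≥0∞) / μ (closedBall x h')) y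
  lazy : ∃ α : ℝ≥0, 0 < α ∧ ∀ x : M, ∀ᵐ y ∂μ, (α : ℝ≥0∞) * p x y ≤ secondKernel μ p x y

/-- The Markov operator restricted to `B`, `P_B f(x) = ∫_B p(x,y) f(y) μ(dy)`. -/
def restrictedOp (μ : Measure M) (p : M → M → ℝ≥0) (B : Set M) (f : M → ℝ) (x : M) : ℝ :=
  ∫ y in B, (p x y : ℝ) * f y ∂μ

/-- The restricted Dirichlet form `E^B(f,f) = ⟨f, (I - P_B) f⟩` in `L²(B)`. -/
def restrictedForm (μ : Measure M) (p : M → M → ℝ≥0) (B : Set M) (f : M → ℝ) : ℝ :=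
  ∫ x in B, f x * (f x - restrictedOp μ p B f x) ∂μ

end MetricMeasure

end

/-!
The proof bounds `P_B f` pointwise by averages of `|f|` and telescopes these averages over dyadic
scales.

Let `F` be the extension of `f` by zero outside `B = B(x₀,r)` and let `A_s F(x)` be the average of
`|F|` over `B(x,s)`. Both large-scale hypotheses hold above some scale `s₀ ≥ h'`, and the upper
bound on the kernel together with local doubling gives `|P_B f| ≤ C A_{s₀} F`
(`enorm_integral_kernel_le`). For `s ≥ s₀` the Poincaré inequality yields
`A_s F(x) ≤ A_{2s} F(x) + C s (V(x,s)⁻¹ ∫_{B(x,ls)} |∇F|_h²)^{1/2}`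
(`ballQuotient_le_add_of_poincare`), so that `A_{s₀} F` is at most the sum of the error terms at the
scales `s = 2^j s₀ < 2^N s₀` plus the average at the scale `2^N s₀` comparable to `r`, which
doubling and the Cauchy-Schwarz inequality bound by `V(x₀,r)^{-1/2} ‖f‖₂` up to a constant.

For the error terms, put `U = V(·,s)⁻¹ ∫_{B(·,ls)} |∇F|_h²`. Its `L¹` norm is at most a constant
times that of `|∇F|_h²` (`lintegral_ballQuotient_le`), and on `B` its supremum is at most
`D^{N+1-j} V(x₀,r)⁻¹ ∫ |∇F|_h²`, where `D` is the doubling constant. Interpolation bounds the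
`L^{2δ/(δ-2)}(B)` norm of `s U^{1/2}` by a constant times
`s (D^{1/δ})^{N+1-j} V(x₀,r)^{-1/δ} (∫ |∇F|_h²)^{1/2}`. Since `δ` may be chosen freely, it is taken
so large that `D^{1/δ} ≤ 3/2 < 2`; then the factor `s = 2^j s₀` wins, and the sum over `j` is of the
order of `r` (`eLpNorm_ballQuotient_le`). When `r ≤ s₀` there are no error terms at all.

Finally, the lower bound on the kernel and symmetry give
`∫ |∇F|_h² ≤ c₁⁻¹ ∬ |F(y) - F(x)|² κ(x,dy) μ(dx) = 2 c₁⁻¹ ⟨f, (I - P_B) f⟩`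
(`lintegral_gradLength_sq_le`, `IsSymmetricTransition.lintegral_sub_sq`).
-/

/-! ### Volumes of balls -/

section Balls

variable {M : Type*} [MetricSpace M] [MeasurableSpace M] {μ : Measure M}

theorem VolumeDoublingLoc.measure_closedBall_lt_top [IsLocallyFiniteMeasure μ]
    (hμ : VolumeDoublingLoc μ) (x : M) (r : ℝ) : μ (closedBall x r) < ∞ := by
  obtain ⟨s, hs, hsμ⟩ := μ.finiteAt_nhds x
  obtain ⟨ε, hε, hεs⟩ := nhds_basis_closedBall.mem_iff.1 hs
  have key : ∀ n : ℕ, μ (closedBall x (2 ^ n * ε)) < ∞ := by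
    intro n
    induction n with
    | zero => simpa using (measure_mono hεs).trans_lt hsμ
    | succ n ih =>
      obtain ⟨C, hC⟩ := hμ (2 ^ n * ε) (by positivity)
      have := hC x
      rw [← mul_assoc, ← pow_succ'] at this
      exact this.trans_lt (ENNReal.mul_lt_top ENNReal.coe_lt_top ih)
  obtain ⟨n, hn⟩ := pow_unbounded_of_one_lt (r / ε) one_lt_two
  refine (measure_mono (closedBall_subset_closedBall ?_)).trans_lt (key n)
  exact ((div_lt_iff₀ hε).1 hn).le

/-- A maximal `ε`-separated set is countable: the disjoint balls of radius `ε / 2` around its points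
have positive measure, and those in a given ball have finite total measure. -/
theorem secondCountableTopology_of_measure_closedBall_lt_top [OpensMeasurableSpace M]
    [μ.IsOpenPosMeasure] (hfin : ∀ (x : M) (r : ℝ), μ (closedBall x r) < ∞) :
    SecondCountableTopology M := by
  refine secondCountable_of_almost_dense_set fun ε hε => ?_
  obtain ⟨A, hA⟩ := zorn_subset {A : Set M | A.Pairwise fun x y => ε < dist x y} (by
    intro c hc hchain
    refine ⟨⋃₀ c, ?_, fun s hs => Set.subset_sUnion_of_mem hs⟩
    exact (Set.pairwise_sUnion hchain.directedOn).2 fun s hs => hc hs)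
  have hsep : A.Pairwise fun x y => ε < dist x y := hA.1
  refine ⟨A, ?_, fun x => ?_⟩
  · rcases A.eq_empty_or_nonempty with hAe | ⟨x₀, -⟩
    · simp [hAe]
    have hcov : A = ⋃ n : ℕ, A ∩ closedBall x₀ n := by
      rw [← Set.inter_iUnion, iUnion_closedBall_nat, Set.inter_univ]
    rw [hcov]
    refine Set.countable_iUnion fun n => ?_
    have hcount := Measure.countable_meas_pos_of_disjoint_of_meas_iUnion_ne_top μ
      (As := fun i : ↥(A ∩ closedBall x₀ n) => ball (i : M) (ε / 2))
      (fun i => isOpen_ball.measurableSet) (by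
        intro i j hij
        refine ball_disjoint_ball ?_
        rw [add_halves]
        exact (hsep i.2.1 j.2.1 (Subtype.coe_ne_coe.2 hij)).le)
      (ne_top_of_le_ne_top (hfin x₀ (n + ε)).ne (measure_mono (Set.iUnion_subset fun i y hy => by
        have h1 := mem_ball.1 hy
        have h2 := mem_closedBall.1 i.2.2
        have h3 := dist_triangle y i x₀
        exact mem_closedBall.2 (by linarith))))
    have huniv : {i : ↥(A ∩ closedBall x₀ n) | 0 < μ (ball (i : M) (ε / 2))} = Set.univ :=
      Set.eq_univ_of_forall fun i => measure_ball_pos μ _ (half_pos hε)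
    rw [huniv, Set.countable_univ_iff] at hcount
    exact hcount
  · by_contra! hx
    have hins : insert x A ∈ {A : Set M | A.Pairwise fun x y => ε < dist x y} := by
      refine hsep.insert fun y hy _ => ⟨hx y hy, ?_⟩
      rw [dist_comm]; exact hx y hy
    have hxA : x ∈ A := hA.2 hins (Set.subset_insert x A) (Set.mem_insert x A)
    have := hx x hxA
    rw [dist_self] at this
    exact absurd this hε.le.not_gt

theorem measure_closedBall_two_pow_mul_le {s₀ : ℝ} (hs₀ : 0 ≤ s₀) {D : ℝ≥0∞}
    (hD : ∀ (x : M) (s : ℝ), s₀ ≤ s → μ (closedBall x (2 * s)) ≤ D * μ (closedBall x s))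
    (k : ℕ) (x : M) {s : ℝ} (hs : s₀ ≤ s) :
    μ (closedBall x (2 ^ k * s)) ≤ D ^ k * μ (closedBall x s) := by
  induction k with
  | zero => simp
  | succ k ih =>
    have h1 : s₀ ≤ 2 ^ k * s :=
      hs.trans (le_mul_of_one_le_left (hs₀.trans hs) (one_le_pow₀ one_le_two))
    calc μ (closedBall x (2 ^ (k + 1) * s)) = μ (closedBall x (2 * (2 ^ k * s))) := by
          rw [pow_succ', mul_assoc]
      _ ≤ D * μ (closedBall x (2 ^ k * s)) := hD x _ h1
      _ ≤ D * (D ^ k * μ (closedBall x s)) := by gcongr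
      _ = D ^ (k + 1) * μ (closedBall x s) := by rw [pow_succ', mul_assoc]

/-- Local doubling compares the volumes of balls of any two fixed radii. -/
theorem VolumeDoublingLoc.exists_measure_closedBall_le (hμ : VolumeDoublingLoc μ) {t : ℝ}
    (ht : 0 < t) (s : ℝ) :
    ∃ C : ℝ≥0, ∀ x : M, μ (closedBall x s) ≤ C * μ (closedBall x t) := by
  have key : ∀ n : ℕ, ∃ C : ℝ≥0, ∀ x : M,
      μ (closedBall x (2 ^ n * t)) ≤ C * μ (closedBall x t) := by
    intro n
    induction n with
    | zero => exact ⟨1, fun x => by simp⟩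
    | succ n ih =>
      obtain ⟨C, hC⟩ := ih
      obtain ⟨C', hC'⟩ := hμ (2 ^ n * t) (by positivity)
      refine ⟨C' * C, fun x => ?_⟩
      rw [pow_succ', mul_assoc]
      refine (hC' x).trans ?_
      rw [ENNReal.coe_mul, mul_assoc]
      gcongr
      exact hC x
  obtain ⟨n, hn⟩ := pow_unbounded_of_one_lt (s / t) one_lt_two
  obtain ⟨C, hC⟩ := key n
  refine ⟨C, fun x => (measure_mono (closedBall_subset_closedBall ?_)).trans (hC x)⟩
  exact ((div_lt_iff₀ ht).1 hn).le

end Balls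

/-! ### Averages over balls -/

section BallQuotient

variable {M : Type*} [MetricSpace M] [MeasurableSpace M] {μ : Measure M}

/-- The quotient `V(x,s)⁻¹ ∫_{B(x,R)} u dμ`. For `R = s` it is the average of `u` over `B(x,s)`;
a larger radius `R` is allowed since the Poincaré inequality enlarges balls. -/
noncomputable def ballQuotient (μ : Measure M) (R s : ℝ) (u : M → ℝ≥0∞) (x : M) : ℝ≥0∞ :=
  (∫⁻ y in closedBall x R, u y ∂μ) / μ (closedBall x s)

theorem ballQuotient_mono (R s : ℝ) {u v : M → ℝ≥0∞} (huv : ∀ y, u y ≤ v y) (x : M) :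
    ballQuotient μ R s u x ≤ ballQuotient μ R s v x :=
  ENNReal.div_le_div_right (lintegral_mono huv) _

variable [BorelSpace M] [SecondCountableTopology M]

theorem measurable_setLIntegral_closedBall [SFinite μ] {u : M × M → ℝ≥0∞} (hu : Measurable u)
    (r : ℝ) : Measurable fun x => ∫⁻ y in closedBall x r, u (x, y) ∂μ := by
  have hset : MeasurableSet {z : M × M | dist z.2 z.1 ≤ r} :=
    measurableSet_le (measurable_snd.dist measurable_fst) measurable_const
  have : (fun x => ∫⁻ y in closedBall x r, u (x, y) ∂μ) =
      fun x => ∫⁻ y, {z : M × M | dist z.2 z.1 ≤ r}.indicator u (x, y) ∂μ := by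
    funext x
    rw [← lintegral_indicator isClosed_closedBall.measurableSet]
    rfl
  rw [this]
  exact Measurable.lintegral_prod_right (hu.indicator hset)

theorem measurable_measure_closedBall [SFinite μ] (r : ℝ) :
    Measurable fun x => μ (closedBall x r) := by
  simpa using measurable_setLIntegral_closedBall (μ := μ)
    (measurable_const (a := (1 : ℝ≥0∞))) r

theorem measurable_ballQuotient [SFinite μ] {u : M → ℝ≥0∞} (hu : Measurable u) (R s : ℝ) :
    Measurable (ballQuotient μ R s u) :=
  (measurable_setLIntegral_closedBall (hu.comp measurable_snd) R).div
    (measurable_measure_closedBall s)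

theorem measurable_gradLength [SFinite μ] {f : M → ℝ} (hf : Measurable f) (h : ℝ) :
    Measurable (gradLength μ h f) := by
  refine Measurable.pow_const (Measurable.div ?_ (measurable_measure_closedBall h)) _
  exact measurable_setLIntegral_closedBall (u := fun z => ‖f z.2 - f z.1‖ₑ ^ 2)
    (((hf.comp measurable_snd).sub (hf.comp measurable_fst)).enorm.pow_const 2) h

/-- Averaging is bounded on `L¹`, by Tonelli's theorem, provided that `V(y,R) ≤ K V(x,s)`
whenever `d(x,y) ≤ R`. -/
theorem lintegral_ballQuotient_le [SFinite μ] [μ.IsOpenPosMeasure] {R s : ℝ} (hR : 0 < R) (hs : 0 < s)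
    (hfin : ∀ (x : M) (r : ℝ), μ (closedBall x r) < ∞) {K : ℝ≥0∞}
    (hK : ∀ x y : M, dist x y ≤ R → μ (closedBall y R) ≤ K * μ (closedBall x s))
    {u : M → ℝ≥0∞} (hu : Measurable u) :
    ∫⁻ x, ballQuotient μ R s u x ∂μ ≤ K * ∫⁻ y, u y ∂μ := by
  have hVm := measurable_measure_closedBall (μ := μ) s
  have hset : MeasurableSet {z : M × M | dist z.2 z.1 ≤ R} :=
    measurableSet_le (measurable_snd.dist measurable_fst) measurable_const
  set w : M × M → ℝ≥0∞ := {z : M × M | dist z.2 z.1 ≤ R}.indicator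
    fun z => u z.2 * (μ (closedBall z.1 s))⁻¹ with hw
  have hwm : Measurable w :=
    ((hu.comp measurable_snd).mul (hVm.comp measurable_fst).inv).indicator hset
  calc ∫⁻ x, ballQuotient μ R s u x ∂μ = ∫⁻ x, ∫⁻ y, w (x, y) ∂μ ∂μ := by
        refine lintegral_congr fun x => ?_
        rw [ballQuotient, div_eq_mul_inv, ← lintegral_mul_const _ hu,
          ← lintegral_indicator isClosed_closedBall.measurableSet]
        rfl
    _ = ∫⁻ y, ∫⁻ x, w (x, y) ∂μ ∂μ := lintegral_lintegral_swap hwm.aemeasurable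
    _ ≤ ∫⁻ y, K * u y ∂μ := by
        refine lintegral_mono fun y => ?_
        have hle : ∀ x, w (x, y) ≤
            (closedBall y R).indicator (fun _ => K * u y / μ (closedBall y R)) x := by
          intro x
          by_cases hxy : dist y x ≤ R
          · have hx : x ∈ closedBall y R := by rwa [mem_closedBall, dist_comm]
            have hx' : (x, y) ∈ {z : M × M | dist z.2 z.1 ≤ R} := hxy
            rw [hw, Set.indicator_of_mem hx', Set.indicator_of_mem hx]
            have hxy' : dist x y ≤ R := by rwa [dist_comm]
            have h1 : (μ (closedBall x s))⁻¹ ≤ K * (μ (closedBall y R))⁻¹ := by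
              have hs0 := (measure_closedBall_pos μ x hs).ne'
              have hR0 := (measure_closedBall_pos μ y hR).ne'
              rw [ENNReal.inv_le_iff_inv_le, ENNReal.mul_inv (.inr (ENNReal.inv_ne_top.2 hR0))
                (.inr (ENNReal.inv_ne_zero.2 (hfin y R).ne)), inv_inv, mul_comm, ← div_eq_mul_inv]
              exact ENNReal.div_le_of_le_mul' (hK x y hxy')
            calc u y * (μ (closedBall x s))⁻¹ ≤ u y * (K * (μ (closedBall y R))⁻¹) := by gcongr
              _ = K * u y / μ (closedBall y R) := by rw [div_eq_mul_inv]; ring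
          · have hx' : (x, y) ∉ {z : M × M | dist z.2 z.1 ≤ R} := hxy
            rw [hw, Set.indicator_of_notMem hx']
            exact zero_le
        refine (lintegral_mono hle).trans ?_
        rw [lintegral_indicator isClosed_closedBall.measurableSet, setLIntegral_const]
        exact (ENNReal.div_mul_cancel (measure_closedBall_pos μ y hR).ne' (hfin y R).ne).le
    _ = K * ∫⁻ y, u y ∂μ := lintegral_const_mul _ hu

end BallQuotient

/-! ### From the Poincaré inequality to a pointwise bound -/

section Chain

variable {M : Type*} [MetricSpace M] [MeasurableSpace M] {μ : Measure M}

theorem gradLength_sq (h : ℝ) (f : M → ℝ) (x : M) :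
    gradLength μ h f x ^ 2 = ballQuotient μ h h (fun y => ‖f y - f x‖ₑ ^ 2) x := by
  rw [gradLength, ballQuotient, ← ENNReal.rpow_natCast, ← ENNReal.rpow_mul]
  norm_num

theorem gradLength_mono (h : ℝ) {f g : M → ℝ} (hfg : ∀ x y, ‖f y - f x‖ₑ ≤ ‖g y - g x‖ₑ) (x : M) :
    gradLength μ h f x ≤ gradLength μ h g x := by
  unfold gradLength
  gcongr
  exact hfg x _

/-- Passing from the average over `B(x,s)` to the one over `B(x,2s)` costs the mean oscillation of
`v` over `B(x,2s)`, which is at most the square root of its mean square. -/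
theorem ballQuotient_le_of_lintegral_sub_average_le [OpensMeasurableSpace M] {v : M → ℝ}
    (hv : Measurable v) {x : M} {s : ℝ} {D A : ℝ≥0∞}
    (hs0 : μ (closedBall x s) ≠ 0) (hsD : μ (closedBall x (2 * s)) ≤ D * μ (closedBall x s))
    (hs : 0 ≤ s) (hfin : μ (closedBall x (2 * s)) < ∞)
    (hP : ∫⁻ y in closedBall x (2 * s), ‖v y - ⨍ z in closedBall x (2 * s), v z ∂μ‖ₑ ^ 2 ∂μ ≤ A) :
    ballQuotient μ s s (‖v ·‖ₑ) x ≤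
      ballQuotient μ (2 * s) (2 * s) (‖v ·‖ₑ) x +
        (D * (A / μ (closedBall x s))) ^ (1 / 2 : ℝ) := by
  set c : ℝ := ⨍ z in closedBall x (2 * s), v z ∂μ with hc
  have hsub : closedBall x s ⊆ closedBall x (2 * s) :=
    closedBall_subset_closedBall (by linarith)
  have hst : μ (closedBall x s) ≠ ∞ := ((measure_mono hsub).trans_lt hfin).ne
  have hcle : ‖c‖ₑ ≤ ballQuotient μ (2 * s) (2 * s) (‖v ·‖ₑ) x := by
    rw [hc, average]
    refine (enorm_integral_le_lintegral_enorm _).trans_eq ?_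
    rw [lintegral_smul_measure, Measure.restrict_apply_univ, ballQuotient, div_eq_mul_inv,
      smul_eq_mul, mul_comm]
  have hCS : ∫⁻ y in closedBall x (2 * s), ‖v y - c‖ₑ ∂μ ≤
      A ^ (1 / 2 : ℝ) * μ (closedBall x (2 * s)) ^ (1 / 2 : ℝ) := by
    have h1 := ENNReal.lintegral_mul_le_Lp_mul_Lq (μ.restrict (closedBall x (2 * s)))
      Real.HolderConjugate.two_two (f := fun y => ‖v y - c‖ₑ) (g := fun _ => 1)
      (hv.sub_const c).enorm.aemeasurable aemeasurable_const
    simp only [Pi.mul_apply, mul_one, ENNReal.one_rpow, lintegral_const,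
      Measure.restrict_apply_univ, one_mul] at h1
    refine h1.trans ?_
    gcongr
    simpa only [ENNReal.rpow_two] using hP
  have h2 : ∫⁻ y in closedBall x s, ‖v y‖ₑ ∂μ ≤
      A ^ (1 / 2 : ℝ) * μ (closedBall x (2 * s)) ^ (1 / 2 : ℝ) + ‖c‖ₑ * μ (closedBall x s) := by
    calc ∫⁻ y in closedBall x s, ‖v y‖ₑ ∂μ
        ≤ ∫⁻ y in closedBall x s, (‖v y - c‖ₑ + ‖c‖ₑ) ∂μ := by
          refine lintegral_mono fun y => ?_
          simpa using enorm_add_le (v y - c) c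
      _ = ∫⁻ y in closedBall x s, ‖v y - c‖ₑ ∂μ + ‖c‖ₑ * μ (closedBall x s) := by
          rw [lintegral_add_right _ measurable_const, setLIntegral_const]
      _ ≤ _ := by
          gcongr
          exact (lintegral_mono_set hsub).trans hCS
  have h3 : A ^ (1 / 2 : ℝ) * μ (closedBall x (2 * s)) ^ (1 / 2 : ℝ) ≤
      (D * (A / μ (closedBall x s))) ^ (1 / 2 : ℝ) * μ (closedBall x s) := by
    calc A ^ (1 / 2 : ℝ) * μ (closedBall x (2 * s)) ^ (1 / 2 : ℝ)
        ≤ (A * (D * μ (closedBall x s))) ^ (1 / 2 : ℝ) := by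
          rw [← ENNReal.mul_rpow_of_nonneg _ _ (by norm_num)]
          gcongr
      _ = (D * (A / μ (closedBall x s)) * μ (closedBall x s) ^ 2) ^ (1 / 2 : ℝ) := by
          congr 1
          rw [pow_two, mul_assoc D, ← mul_assoc (A / _), ENNReal.div_mul_cancel hs0 hst]
          ring
      _ = _ := by
          rw [ENNReal.mul_rpow_of_nonneg _ _ (by norm_num : (0 : ℝ) ≤ 1 / 2),
            ← ENNReal.rpow_natCast (μ (closedBall x s)), ← ENNReal.rpow_mul]
          norm_num
  refine ENNReal.div_le_of_le_mul ((h2.trans (add_le_add h3 (mul_le_mul_left hcle _))).trans_eq ?_)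
  rw [add_mul, add_comm]

/-- The truncations `min |f| n` are bounded, so that the Poincaré inequality applies to them, and
have smaller gradients than `f`; monotone convergence then gives the bound for `f` itself. -/
theorem ballQuotient_le_add_of_poincare [BorelSpace M] {h : ℝ} {C₁ : ℝ≥0} {C₂ r₀ : ℝ}
    (hP : ∀ f : M → ℝ, MemLinftyLoc μ f → ∀ (x : M) (r : ℝ), r₀ ≤ r →
      ∫⁻ y in closedBall x r, ‖f y - ⨍ z in closedBall x r, f z ∂μ‖ₑ ^ 2 ∂μ ≤
        C₁ * ENNReal.ofReal (r ^ 2) *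
          ∫⁻ y in closedBall x (C₂ * r), gradLength μ h f y ^ 2 ∂μ)
    [IsFiniteMeasureOnCompacts μ] {f : M → ℝ} (hf : Measurable f) {x : M} {s : ℝ} {D : ℝ≥0}
    (hs0 : μ (closedBall x s) ≠ 0) (hsD : μ (closedBall x (2 * s)) ≤ D * μ (closedBall x s))
    (hs : 0 ≤ s) (hrs : r₀ ≤ 2 * s) (hfin : μ (closedBall x (2 * s)) < ∞) :
    ballQuotient μ s s (‖f ·‖ₑ) x ≤
      ballQuotient μ (2 * s) (2 * s) (‖f ·‖ₑ) x +
        ENNReal.ofReal (2 * s) * ((D * C₁ : ℝ≥0) *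
          ballQuotient μ (C₂ * (2 * s)) s (fun y => gradLength μ h f y ^ 2) x) ^ (1 / 2 : ℝ) := by
  set v : ℕ → M → ℝ := fun n y => min |f y| n with hvdef
  have hvm : ∀ n, Measurable (v n) := fun n => hf.abs.min measurable_const
  have hvn : ∀ n y, ‖v n y‖ₑ = min ‖f y‖ₑ n := by
    intro n y
    rw [Real.enorm_eq_ofReal (le_min (abs_nonneg _) n.cast_nonneg), ENNReal.ofReal_min,
      ENNReal.ofReal_natCast, ← Real.enorm_eq_ofReal_abs]
  have hvle : ∀ n y, ‖v n y‖ₑ ≤ ‖f y‖ₑ := fun n y => (hvn n y).trans_le (min_le_left _ _)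
  have hgrad : ∀ n y, gradLength μ h (v n) y ≤ gradLength μ h f y := by
    intro n
    refine gradLength_mono h fun x y => ?_
    rw [enorm_le_iff_norm_le, Real.norm_eq_abs, Real.norm_eq_abs]
    exact (abs_inf_sub_inf_le_abs _ _ _).trans (abs_abs_sub_abs_le _ _)
  have hmem : ∀ n, MemLinftyLoc μ (v n) := by
    refine fun n => ⟨(hvm n).aestronglyMeasurable, fun K hK => ?_⟩
    have : IsFiniteMeasure (μ.restrict K) := ⟨by simpa using hK.measure_lt_top⟩
    refine MemLp.of_bound (hvm n).aestronglyMeasurable.restrict n (.of_forall fun y => ?_)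
    rw [Real.norm_eq_abs, abs_of_nonneg (le_min (abs_nonneg _) n.cast_nonneg)]
    exact min_le_right _ _
  have hstep : ∀ n, ballQuotient μ s s (‖v n ·‖ₑ) x ≤
      ballQuotient μ (2 * s) (2 * s) (‖f ·‖ₑ) x +
        ENNReal.ofReal (2 * s) * ((D * C₁ : ℝ≥0) *
          ballQuotient μ (C₂ * (2 * s)) s (fun y => gradLength μ h f y ^ 2) x) ^ (1 / 2 : ℝ) := by
    intro n
    refine (ballQuotient_le_of_lintegral_sub_average_le (hvm n) hs0 hsD hs hfin
      (hP (v n) (hmem n) x (2 * s) hrs)).trans (add_le_add (ballQuotient_mono _ _ (hvle n) x) ?_)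
    have h1 : ENNReal.ofReal (2 * s) = (ENNReal.ofReal ((2 * s) ^ 2)) ^ (1 / 2 : ℝ) := by
      rw [ENNReal.ofReal_pow (by positivity), ← ENNReal.rpow_natCast, ← ENNReal.rpow_mul]
      norm_num
    rw [h1, ← ENNReal.mul_rpow_of_nonneg _ _ (by norm_num)]
    refine ENNReal.rpow_le_rpow ?_ (by norm_num)
    calc (D : ℝ≥0∞) * (C₁ * ENNReal.ofReal ((2 * s) ^ 2) *
            (∫⁻ y in closedBall x (C₂ * (2 * s)), gradLength μ h (v n) y ^ 2 ∂μ) /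
              μ (closedBall x s))
        = ENNReal.ofReal ((2 * s) ^ 2) * ((D * C₁ : ℝ≥0) *
          ballQuotient μ (C₂ * (2 * s)) s (fun y => gradLength μ h (v n) y ^ 2) x) := by
          rw [ballQuotient, ENNReal.coe_mul]
          simp only [div_eq_mul_inv]
          ring
      _ ≤ _ := by
          gcongr
          exact ballQuotient_mono _ _ (fun y => by gcongr; exact hgrad n y) x
  have hsup : ∫⁻ y in closedBall x s, ‖f y‖ₑ ∂μ =
      ⨆ n, ∫⁻ y in closedBall x s, ‖v n y‖ₑ ∂μ := by
    rw [← lintegral_iSup (fun n => (hvm n).enorm) (fun m n hmn y => by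
      simp only [hvn]; gcongr)]
    refine lintegral_congr fun y => le_antisymm ?_ (iSup_le fun n => hvle n y)
    obtain ⟨n, hn⟩ := ENNReal.exists_nat_gt (enorm_ne_top (x := f y))
    refine le_iSup_of_le n ?_
    rw [hvn, min_eq_left hn.le]
  rw [ballQuotient, hsup, ENNReal.iSup_div]
  exact iSup_le hstep

end Chain

/-! ### The Dirichlet form of a symmetric Markov kernel -/

section Energy

variable {M : Type*} [MeasurableSpace M] {μ : Measure M} {κ : Kernel M M}

theorem IsSymmetricTransition.measurePreserving_snd [SFinite μ] [IsMarkovKernel κ]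
    (hκ : IsSymmetricTransition μ κ) : MeasurePreserving Prod.snd (μ ⊗ₘ κ) μ := by
  refine ⟨measurable_snd, Measure.ext fun s hs => ?_⟩
  have h1 := hκ (fun _ => 1) (s.indicator fun _ => 1) measurable_const
    (measurable_const.indicator hs)
  rw [Measure.map_apply measurable_snd hs, Measure.compProd_apply (measurable_snd hs)]
  have h2 : ∀ x : M, ((s.indicator (fun _ => (1 : ℝ≥0)) x : ℝ≥0) : ℝ≥0∞) =
      s.indicator (fun _ => 1) x := by
    intro x; by_cases hx : x ∈ s <;> simp [hx]
  simp only [ENNReal.coe_one, one_mul, mul_one, h2, lintegral_const, measure_univ,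
    lintegral_indicator hs, Measure.restrict_apply_univ] at h1
  exact h1

/-- `∬ |f(y) - f(x)|² κ(x,dy) μ(dx) = 2 ⟨f, (I - P) f⟩`, since both marginals of the symmetric
measure `κ(x,dy) μ(dx)` are `μ`. -/
theorem IsSymmetricTransition.lintegral_sub_sq [SFinite μ] [IsMarkovKernel κ]
    (hκ : IsSymmetricTransition μ κ) {f : M → ℝ} (hf : Measurable f) (hf2 : MemLp f 2 μ) :
    ∫⁻ x, ∫⁻ y, ‖f y - f x‖ₑ ^ 2 ∂(κ x) ∂μ =
        ENNReal.ofReal (2 * ∫ x, f x * (f x - ∫ y, f y ∂(κ x)) ∂μ) ∧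
      0 ≤ ∫ x, f x * (f x - ∫ y, f y ∂(κ x)) ∂μ := by
  have hfst : MeasurePreserving Prod.fst (μ ⊗ₘ κ) μ :=
    ⟨measurable_fst, Measure.fst_compProd μ κ⟩
  have hsnd := hκ.measurePreserving_snd
  have h1 : MemLp (fun z : M × M => f z.1) 2 (μ ⊗ₘ κ) := hf2.comp_measurePreserving hfst
  have h2 : MemLp (fun z : M × M => f z.2) 2 (μ ⊗ₘ κ) := hf2.comp_measurePreserving hsnd
  have h12 : Integrable (fun z : M × M => f z.1 * f z.2) (μ ⊗ₘ κ) := h1.integrable_mul h2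
  have e1 : ∫ z, f z.1 ^ 2 ∂(μ ⊗ₘ κ) = ∫ x, f x ^ 2 ∂μ := by
    conv_rhs => rw [← hfst.map_eq]
    rw [integral_map measurable_fst.aemeasurable (hf.pow_const 2).aestronglyMeasurable]
  have e2 : ∫ z, f z.2 ^ 2 ∂(μ ⊗ₘ κ) = ∫ x, f x ^ 2 ∂μ := by
    conv_rhs => rw [← hsnd.map_eq]
    rw [integral_map measurable_snd.aemeasurable (hf.pow_const 2).aestronglyMeasurable]
  have e12 : ∫ z, f z.1 * f z.2 ∂(μ ⊗ₘ κ) = ∫ x, f x * ∫ y, f y ∂(κ x) ∂μ := by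
    rw [Measure.integral_compProd h12]
    simp only [integral_const_mul]
  have hint : Integrable (fun x => f x * ∫ y, f y ∂(κ x)) μ := by
    have := h12.integral_compProd
    simp only [integral_const_mul] at this
    exact this
  have hs1 : Integrable (fun z : M × M => f z.1 ^ 2) (μ ⊗ₘ κ) := h1.integrable_sq
  have hs2 : Integrable (fun z : M × M => f z.2 ^ 2) (μ ⊗ₘ κ) := h2.integrable_sq
  have hs21 : Integrable (fun z : M × M => (f z.2 - f z.1) ^ 2) (μ ⊗ₘ κ) :=
    (h2.sub h1).integrable_sq
  have hs12 : Integrable (fun z : M × M => f z.2 ^ 2 + f z.1 ^ 2) (μ ⊗ₘ κ) := hs2.add hs1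
  have hform : ∫ x, f x * (f x - ∫ y, f y ∂(κ x)) ∂μ =
      ∫ x, f x ^ 2 ∂μ - ∫ z, f z.1 * f z.2 ∂(μ ⊗ₘ κ) := by
    rw [e12, ← integral_sub hf2.integrable_sq hint]
    refine integral_congr_ae (.of_forall fun x => ?_)
    simp only
    ring
  have hsq : ∫ z, (f z.2 - f z.1) ^ 2 ∂(μ ⊗ₘ κ) =
      2 * ∫ x, f x * (f x - ∫ y, f y ∂(κ x)) ∂μ := by
    have : ∀ z : M × M, (f z.2 - f z.1) ^ 2 = f z.2 ^ 2 + f z.1 ^ 2 - 2 * (f z.1 * f z.2) :=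
      fun z => by ring
    simp only [this]
    rw [integral_sub hs12 (h12.const_mul 2), integral_add hs2 hs1, integral_const_mul, e1, e2, hform]
    ring
  refine ⟨?_, ?_⟩
  · have hm : Measurable fun z : M × M => ‖f z.2 - f z.1‖ₑ ^ 2 :=
      ((hf.comp measurable_snd).sub (hf.comp measurable_fst)).enorm.pow_const 2
    rw [← hsq, ofReal_integral_eq_lintegral_ofReal hs21
      (.of_forall fun z => sq_nonneg _), ← Measure.lintegral_compProd hm]
    refine lintegral_congr fun z => ?_
    rw [← sq_abs, ENNReal.ofReal_pow (abs_nonneg _), ← Real.enorm_eq_ofReal_abs]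
  · have : 0 ≤ ∫ z, (f z.2 - f z.1) ^ 2 ∂(μ ⊗ₘ κ) := integral_nonneg fun z => sq_nonneg _
    linarith

end Energy

section Compatible

variable {M : Type*} [MetricSpace M] [MeasurableSpace M] {μ : Measure M} {κ : Kernel M M}
  {h h' : ℝ} {p : M → M → ℝ≥0}

theorem IsCompatible.kernel_eq_withDensity (hp : IsCompatible μ h h' κ p) (x : M) :
    κ x = μ.withDensity fun y => (p x y : ℝ≥0∞) :=
  Measure.ext fun A hA => by rw [hp.density x A hA, withDensity_apply _ hA]

theorem IsCompatible.integral_kernel (hp : IsCompatible μ h h' κ p) (f : M → ℝ) (x : M) :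
    ∫ y, f y ∂(κ x) = ∫ y, (p x y : ℝ) * f y ∂μ := by
  rw [hp.kernel_eq_withDensity,
    integral_withDensity_eq_integral_smul (hp.measurable_kernel x)]
  rfl

/-- `P_B f = P (1_B f)`. -/
theorem IsCompatible.restrictedOp_eq_integral (hp : IsCompatible μ h h' κ p) {B : Set M}
    (hB : MeasurableSet B) {f g : M → ℝ} (hfg : f =ᵐ[μ.restrict B] g) (x : M) :
    restrictedOp μ p B f x = ∫ y, B.indicator g y ∂(κ x) := by
  rw [hp.integral_kernel, restrictedOp]
  have : (fun y => (p x y : ℝ) * B.indicator g y) = B.indicator fun y => (p x y : ℝ) * g y := by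
    funext y
    rw [Set.indicator_mul_right]
  rw [this, integral_indicator hB]
  exact integral_congr_ae (hfg.mono fun y hy => by simp only [hy])

theorem IsCompatible.restrictedForm_eq_integral (hp : IsCompatible μ h h' κ p) {B : Set M}
    (hB : MeasurableSet B) {f g : M → ℝ} (hfg : f =ᵐ[μ.restrict B] g) :
    restrictedForm μ p B f =
      ∫ x, B.indicator g x * (B.indicator g x - ∫ y, B.indicator g y ∂(κ x)) ∂μ := by
  have h1 : (fun x => B.indicator g x * (B.indicator g x - ∫ y, B.indicator g y ∂(κ x))) =
      B.indicator fun x => g x * (g x - ∫ y, B.indicator g y ∂(κ x)) := by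
    funext x
    by_cases hx : x ∈ B <;> simp [hx]
  rw [h1, integral_indicator hB, restrictedForm]
  refine integral_congr_ae (hfg.mono fun x hx => ?_)
  simp only [hx, hp.restrictedOp_eq_integral hB hfg]

/-- The lower bound on the kernel: the energy of the gradient at scale `h` is controlled by the
Dirichlet form. -/
theorem lintegral_gradLength_sq_le [BorelSpace M]
    (hp : IsCompatible μ h h' κ p) {c₁ : ℝ≥0} (hc₁ : 0 < c₁)
    (hlow : ∀ x : M, ∀ᵐ y ∂μ,
      (closedBall x h).indicator (fun _ => (c₁ : ℝ≥0∞) / μ (closedBall x h)) y ≤ p x y)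
    {f : M → ℝ} (hf : Measurable f) :
    ∫⁻ x, gradLength μ h f x ^ 2 ∂μ ≤
      (c₁⁻¹ : ℝ≥0) * ∫⁻ x, ∫⁻ y, ‖f y - f x‖ₑ ^ 2 ∂(κ x) ∂μ := by
  rw [← lintegral_const_mul' _ _ ENNReal.coe_ne_top]
  refine lintegral_mono fun x => ?_
  have hm : Measurable fun y => ‖f y - f x‖ₑ ^ 2 := (hf.sub_const _).enorm.pow_const 2
  rw [gradLength_sq, ballQuotient, hp.kernel_eq_withDensity, lintegral_withDensity_eq_lintegral_mul
    _ (hp.measurable_kernel x).coe_nnreal_ennreal hm, ← lintegral_const_mul' _ _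
    ENNReal.coe_ne_top, div_eq_mul_inv, ← lintegral_mul_const _ hm,
    ← lintegral_indicator isClosed_closedBall.measurableSet]
  refine lintegral_mono_ae ((hlow x).mono fun y hy => ?_)
  by_cases hyx : y ∈ closedBall x h
  · rw [Set.indicator_of_mem hyx] at hy ⊢
    have h1 : (μ (closedBall x h))⁻¹ ≤ (c₁⁻¹ : ℝ≥0) * p x y := by
      calc (μ (closedBall x h))⁻¹ = (c₁⁻¹ : ℝ≥0) * (c₁ / μ (closedBall x h)) := by
            rw [div_eq_mul_inv, ← mul_assoc, ← ENNReal.coe_mul, inv_mul_cancel₀ hc₁.ne',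
              ENNReal.coe_one, one_mul]
        _ ≤ _ := by gcongr
    calc ‖f y - f x‖ₑ ^ 2 * (μ (closedBall x h))⁻¹
        ≤ ‖f y - f x‖ₑ ^ 2 * ((c₁⁻¹ : ℝ≥0) * p x y) := by gcongr
      _ = _ := by rw [Pi.mul_apply]; ring
  · rw [Set.indicator_of_notMem hyx]
    exact zero_le

/-- The upper bound on the kernel: `|P f|` is controlled by averages of `|f|` at scale `h'`. -/
theorem enorm_integral_kernel_le [BorelSpace M]
    (hp : IsCompatible μ h h' κ p) {C₁ : ℝ≥0}
    (hup : ∀ x : M, ∀ᵐ y ∂μ,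
      (p x y : ℝ≥0∞) ≤ (closedBall x h').indicator (fun _ => (C₁ : ℝ≥0∞) / μ (closedBall x h')) y)
    {f : M → ℝ} (hf : Measurable f) (x : M) :
    ‖∫ y, f y ∂(κ x)‖ₑ ≤ C₁ * ballQuotient μ h' h' (‖f ·‖ₑ) x := by
  refine (enorm_integral_le_lintegral_enorm _).trans ?_
  rw [ballQuotient, hp.kernel_eq_withDensity, lintegral_withDensity_eq_lintegral_mul
    _ (hp.measurable_kernel x).coe_nnreal_ennreal hf.enorm, div_eq_mul_inv,
    ← lintegral_mul_const _ hf.enorm, ← lintegral_const_mul' _ _ ENNReal.coe_ne_top,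
    ← lintegral_indicator isClosed_closedBall.measurableSet]
  refine lintegral_mono_ae ((hup x).mono fun y hy => ?_)
  rw [Pi.mul_apply]
  by_cases hyx : y ∈ closedBall x h'
  · rw [Set.indicator_of_mem hyx] at hy ⊢
    calc (p x y : ℝ≥0∞) * ‖f y‖ₑ ≤ C₁ / μ (closedBall x h') * ‖f y‖ₑ := by gcongr
      _ = _ := by rw [div_eq_mul_inv]; ring
  · rw [Set.indicator_of_notMem hyx] at hy ⊢
    rw [nonpos_iff_eq_zero.1 hy, zero_mul]

end Compatible

/-! ### Summation over dyadic scales -/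

/-- Interpolation of `L^{q/2}`, `q = 2δ/(δ-2)`, between `L¹` and `L^∞`, written for the square root
of `u`. -/
theorem eLpNorm_const_mul_sqrt_le {α : Type*} [MeasurableSpace α] {ν : Measure α} {δ : ℝ}
    (hδ : 2 < δ) {u : α → ℝ≥0∞} (hu : AEMeasurable u ν) (c : ℝ≥0∞) {A : ℝ≥0∞}
    (hA : ∀ᵐ x ∂ν, u x ≤ A) :
    eLpNorm (fun x => c * u x ^ (1 / 2 : ℝ)) (ENNReal.ofReal (2 * δ / (δ - 2))) ν ≤
      c * (A ^ (1 / δ) * (∫⁻ x, u x ∂ν) ^ (1 / 2 - 1 / δ)) := by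
  have hδ2 : 0 < δ - 2 := by linarith
  have hδ0 : 0 < δ := by linarith
  set q : ℝ := 2 * δ / (δ - 2) with hq
  have hq0 : 0 < q := by positivity
  have hqinv : 1 / q = 1 / 2 - 1 / δ := by rw [hq]; field_simp
  have hqA : 2 / (δ - 2) * (1 / q) = 1 / δ := by rw [hq]; field_simp
  have hqu : 1 / 2 * q = 2 / (δ - 2) + 1 := by rw [hq]; field_simp; ring
  rw [eLpNorm_eq_lintegral_rpow_enorm_toReal (by simpa using hq0) ENNReal.ofReal_ne_top,
    ENNReal.toReal_ofReal hq0.le]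
  simp only [enorm_eq_self]
  have h1 : ∫⁻ x, (c * u x ^ (1 / 2 : ℝ)) ^ q ∂ν ≤
      c ^ q * (A ^ (2 / (δ - 2)) * ∫⁻ x, u x ∂ν) := by
    rw [← lintegral_const_mul'' _ hu, ← lintegral_const_mul'' _ (hu.const_mul _)]
    refine lintegral_mono_ae (hA.mono fun x hx => ?_)
    rw [ENNReal.mul_rpow_of_nonneg _ _ hq0.le, ← ENNReal.rpow_mul, hqu,
      ENNReal.rpow_add_of_nonneg _ _ (by positivity) zero_le_one, ENNReal.rpow_one]
    gcongr
  calc (∫⁻ x, (c * u x ^ (1 / 2 : ℝ)) ^ q ∂ν) ^ (1 / q)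
      ≤ (c ^ q * (A ^ (2 / (δ - 2)) * ∫⁻ x, u x ∂ν)) ^ (1 / q) := by gcongr
    _ = _ := by
      rw [ENNReal.mul_rpow_of_nonneg _ _ (by positivity),
        ENNReal.mul_rpow_of_nonneg _ _ (by positivity), ← ENNReal.rpow_mul, ← ENNReal.rpow_mul,
        hqA, mul_one_div_cancel hq0.ne', ENNReal.rpow_one, hqinv]

theorem sum_two_pow_mul_three_half_pow (N : ℕ) :
    ∑ j ∈ Finset.range N, (2 : ℝ) ^ j * (3 / 2) ^ (N - j) = 3 * (2 ^ N - (3 / 2) ^ N) := by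
  induction N with
  | zero => simp
  | succ N ih =>
    rw [Finset.sum_range_succ]
    have : ∀ j ∈ Finset.range N, (2 : ℝ) ^ j * (3 / 2) ^ (N + 1 - j) =
        3 / 2 * (2 ^ j * (3 / 2) ^ (N - j)) := by
      intro j hj
      rw [Nat.succ_sub (Finset.mem_range.1 hj).le, pow_succ]
      ring
    rw [Finset.sum_congr rfl this, ← Finset.mul_sum, ih, Nat.add_sub_cancel_left]
    ring

theorem exists_two_pow_mul_near {s₀ r : ℝ} (hs₀ : 0 < s₀) :
    ∃ N : ℕ, r ≤ 2 ^ N * s₀ ∧ (N = 0 ∨ 2 ^ N * s₀ ≤ 2 * r) := by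
  by_cases hr : r ≤ s₀
  · exact ⟨0, by simpa using hr, .inl rfl⟩
  · push Not at hr
    obtain ⟨n, h1, h2⟩ := exists_nat_pow_near ((one_le_div hs₀).2 hr.le) one_lt_two
    refine ⟨n + 1, ((div_lt_iff₀ hs₀).1 h2).le, .inr ?_⟩
    have := (le_div_iff₀ hs₀).1 h1
    rw [pow_succ]
    linarith

section Dyadic

variable {M : Type*} [MetricSpace M] [MeasurableSpace M] {μ : Measure M}

theorem ballQuotient_le_of_measure_le {B : Set M} (hB0 : μ B ≠ 0) (hBt : μ B ≠ ∞) {x : M} {s : ℝ}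
    {A : ℝ≥0∞} (hA : μ B ≤ A * μ (closedBall x s)) (R : ℝ) (w : M → ℝ≥0∞) :
    ballQuotient μ R s w x ≤ A * (μ B)⁻¹ * ∫⁻ y, w y ∂μ := by
  refine ENNReal.div_le_of_le_mul ?_
  calc ∫⁻ y in closedBall x R, w y ∂μ ≤ ∫⁻ y, w y ∂μ := setLIntegral_le_lintegral _ _
    _ = ((μ B)⁻¹ * ∫⁻ y, w y ∂μ) * μ B := by
      rw [mul_comm, ← mul_assoc, ENNReal.mul_inv_cancel hB0 hBt, one_mul]
    _ ≤ ((μ B)⁻¹ * ∫⁻ y, w y ∂μ) * (A * μ (closedBall x s)) := by gcongr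
    _ = _ := by ring

/-- Averages of a function supported in `B` over balls that are not small compared to `B`: here
the supremum is bounded by the `L²` norm. -/
theorem eLpNorm_ballQuotient_le_of_support {B : Set M} (hB : MeasurableSet B) (hB0 : μ B ≠ 0)
    (hBt : μ B ≠ ∞) {δ s : ℝ} (hδ : 2 < δ) {D : ℝ≥0∞}
    (hD : ∀ x ∈ B, μ B ≤ D * μ (closedBall x s))
    {φ : M → ℝ≥0∞} (hφ : Measurable φ) (hsupp : ∀ y ∉ B, φ y = 0) :
    eLpNorm (ballQuotient μ s s φ) (ENNReal.ofReal (2 * δ / (δ - 2))) (μ.restrict B) ≤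
      D * (μ B ^ (1 / δ))⁻¹ * (∫⁻ y, φ y ^ 2 ∂μ) ^ (1 / 2 : ℝ) := by
  have hδ2 : 0 < δ - 2 := by linarith
  have hδ0 : 0 < δ := by linarith
  have hφ1 : ∫⁻ y, φ y ∂μ ≤ (∫⁻ y, φ y ^ 2 ∂μ) ^ (1 / 2 : ℝ) * μ B ^ (1 / 2 : ℝ) := by
    have h1 := ENNReal.lintegral_mul_le_Lp_mul_Lq (μ.restrict B)
      Real.HolderConjugate.two_two (f := φ) (g := fun _ => 1) hφ.aemeasurable aemeasurable_const
    simp only [Pi.mul_apply, mul_one, ENNReal.rpow_two, one_pow, lintegral_const,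
      Measure.restrict_apply_univ, one_mul] at h1
    have h2 : ∫⁻ y, φ y ∂μ = ∫⁻ y in B, φ y ∂μ := by
      rw [← lintegral_indicator hB]
      refine lintegral_congr fun y => ?_
      by_cases hy : y ∈ B
      · rw [Set.indicator_of_mem hy]
      · rw [Set.indicator_of_notMem hy, hsupp y hy]
    rw [h2]
    refine h1.trans ?_
    gcongr
    exact Measure.restrict_le_self
  have hae : ∀ᵐ x ∂(μ.restrict B), ‖ballQuotient μ s s φ x‖ₑ ≤
      ‖D * (μ B)⁻¹ * ((∫⁻ y, φ y ^ 2 ∂μ) ^ (1 / 2 : ℝ) * μ B ^ (1 / 2 : ℝ))‖ₑ := by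
    refine (ae_restrict_iff' hB).2 (.of_forall fun x hx => ?_)
    simp only [enorm_eq_self]
    exact (ballQuotient_le_of_measure_le hB0 hBt (hD x hx) s φ).trans (by gcongr)
  refine (eLpNorm_mono_enorm_ae hae).trans_eq ?_
  rw [eLpNorm_const' _ (by simpa using by positivity) ENNReal.ofReal_ne_top,
    ENNReal.toReal_ofReal (by positivity), enorm_eq_self, Measure.restrict_apply_univ]
  have hexp : (1 / (2 * δ / (δ - 2)) : ℝ) = 1 / 2 - 1 / δ := by field_simp
  have hVp : (μ B)⁻¹ * μ B ^ (1 / 2 : ℝ) * μ B ^ (1 / 2 - 1 / δ) = (μ B ^ (1 / δ))⁻¹ := by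
    rw [← ENNReal.rpow_neg_one, ← ENNReal.rpow_neg, ← ENNReal.rpow_add _ _ hB0 hBt,
      ← ENNReal.rpow_add _ _ hB0 hBt]
    congr 1
    ring
  rw [hexp, ← hVp]
  ring

variable [BorelSpace M] [SecondCountableTopology M] [SFinite μ] [μ.IsOpenPosMeasure]

/-- The `L^{2δ/(δ-2)}(B)` norm of the square root of an average over balls of radius `s`, where
`B` has at most `D^k` times the volume of any such ball centred in `B`. -/
theorem eLpNorm_sqrt_ballQuotient_le {B : Set M} (hB : MeasurableSet B) (hB0 : μ B ≠ 0)
    (hBt : μ B ≠ ∞) {R s δ : ℝ} (hR : 0 < R) (hs : 0 < s) (hδ : 2 < δ) {D K : ℝ≥0}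
    (hfin : ∀ (x : M) (r : ℝ), μ (closedBall x r) < ∞)
    {θ : ℝ} (hDδ : (D : ℝ≥0∞) ^ (1 / δ) ≤ ENNReal.ofReal θ) {k : ℕ}
    (hD : ∀ x ∈ B, μ B ≤ D ^ k * μ (closedBall x s))
    (hK : ∀ x y : M, dist x y ≤ R → μ (closedBall y R) ≤ K * μ (closedBall x s))
    {u : M → ℝ≥0∞} (hu : Measurable u) (c : ℝ≥0∞) :
    eLpNorm (fun x => c * ballQuotient μ R s u x ^ (1 / 2 : ℝ))
        (ENNReal.ofReal (2 * δ / (δ - 2))) (μ.restrict B) ≤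
      c * (ENNReal.ofReal θ ^ k * (μ B ^ (1 / δ))⁻¹ * K ^ (1 / 2 - 1 / δ) *
        (∫⁻ y, u y ∂μ) ^ (1 / 2 : ℝ)) := by
  have hδ0 : 0 < δ := by linarith
  have hδh : 0 < 1 / 2 - 1 / δ := by
    rw [sub_pos]; exact one_div_lt_one_div_of_lt two_pos hδ
  have hint : ∫⁻ x in B, ballQuotient μ R s u x ∂μ ≤ K * ∫⁻ y, u y ∂μ :=
    (setLIntegral_le_lintegral _ _).trans (lintegral_ballQuotient_le hR hs hfin hK hu)
  have hsup : ∀ᵐ x ∂(μ.restrict B), ballQuotient μ R s u x ≤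
      (D : ℝ≥0∞) ^ k * (μ B)⁻¹ * ∫⁻ y, u y ∂μ :=
    (ae_restrict_iff' hB).2 (.of_forall fun x hx =>
      ballQuotient_le_of_measure_le hB0 hBt (hD x hx) R u)
  refine (eLpNorm_const_mul_sqrt_le hδ (measurable_ballQuotient hu _ _).aemeasurable _
    hsup).trans ?_
  have hGp : (∫⁻ y, u y ∂μ) ^ (1 / δ) * (∫⁻ y, u y ∂μ) ^ (1 / 2 - 1 / δ) =
      (∫⁻ y, u y ∂μ) ^ (1 / 2 : ℝ) := by
    rw [← ENNReal.rpow_add_of_nonneg _ _ (by positivity) hδh.le]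
    congr 1
    ring
  have hDp : ((D : ℝ≥0∞) ^ k) ^ (1 / δ) ≤ ENNReal.ofReal θ ^ k := by
    rw [← ENNReal.rpow_natCast, ← ENNReal.rpow_mul, mul_comm, ENNReal.rpow_mul,
      ENNReal.rpow_natCast]
    gcongr
  have h1 : ((D : ℝ≥0∞) ^ k * (μ B)⁻¹ * ∫⁻ y, u y ∂μ) ^ (1 / δ) ≤
      ENNReal.ofReal θ ^ k * (μ B ^ (1 / δ))⁻¹ * (∫⁻ y, u y ∂μ) ^ (1 / δ) := by
    rw [ENNReal.mul_rpow_of_nonneg _ _ (by positivity),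
      ENNReal.mul_rpow_of_nonneg _ _ (by positivity), ENNReal.inv_rpow]
    gcongr
  have h2 : (∫⁻ x in B, ballQuotient μ R s u x ∂μ) ^ (1 / 2 - 1 / δ) ≤
      K ^ (1 / 2 - 1 / δ) * (∫⁻ y, u y ∂μ) ^ (1 / 2 - 1 / δ) := by
    rw [← ENNReal.mul_rpow_of_nonneg _ _ hδh.le]
    gcongr
  refine mul_le_mul_right ((mul_le_mul' h1 h2).trans_eq ?_) c
  rw [← hGp]
  ring

/-- The bound for the average at scale `s₀` of a function `φ` supported in the ball `B(x₀,r)`: by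
telescoping over the scales `2^j s₀ ≤ 2r`, it is at most the average at a scale comparable to `r`
plus `∑ⱼ 2^(j+1) s₀ (L uⱼ)^(1/2)`, where `uⱼ` averages `u` at scale `2^j s₀`. The `L¹` norm of `uⱼ`
is bounded by that of `u`, its supremum by a factor that doubling controls; as `D ≤ (3/2)^δ`, the
resulting `L^{2δ/(δ-2)}` norms grow geometrically in `j`, so that the largest scale dominates. -/
theorem eLpNorm_ballQuotient_le {s₀ l δ : ℝ} (hs₀ : 0 < s₀) (hl : 0 < l) (hδ : 2 < δ)
    {D K L : ℝ≥0} (hfin : ∀ (x : M) (r : ℝ), μ (closedBall x r) < ∞)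
    (hD : ∀ (x : M) (s : ℝ), s₀ ≤ s → μ (closedBall x (2 * s)) ≤ D * μ (closedBall x s))
    (hDδ : (D : ℝ≥0∞) ^ (1 / δ) ≤ ENNReal.ofReal (3 / 2))
    (hK : ∀ s : ℝ, s₀ ≤ s → ∀ x y : M, dist x y ≤ l * s →
      μ (closedBall y (l * s)) ≤ K * μ (closedBall x s))
    {φ u : M → ℝ≥0∞} (hφ : Measurable φ) (hu : Measurable u)
    (hstep : ∀ (x : M) (s : ℝ), s₀ ≤ s → ballQuotient μ s s φ x ≤
      ballQuotient μ (2 * s) (2 * s) φ x +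
        ENNReal.ofReal (2 * s) * (L * ballQuotient μ (l * s) s u x) ^ (1 / 2 : ℝ))
    {x₀ : M} {r : ℝ} (hr : 0 < r) (hsupp : ∀ y ∉ closedBall x₀ r, φ y = 0) :
    eLpNorm (ballQuotient μ s₀ s₀ φ) (ENNReal.ofReal (2 * δ / (δ - 2)))
        (μ.restrict (closedBall x₀ r)) ≤
      (18 * L ^ (1 / 2 : ℝ) * K ^ (1 / 2 - 1 / δ) + D : ℝ≥0) *
        (μ (closedBall x₀ r) ^ (1 / δ))⁻¹ *
        (ENNReal.ofReal r * (∫⁻ y, u y ∂μ) ^ (1 / 2 : ℝ) +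
          (∫⁻ y, φ y ^ 2 ∂μ) ^ (1 / 2 : ℝ)) := by
  have hδ2 : 0 < δ - 2 := by linarith
  have hδ0 : 0 < δ := by linarith
  have hδh : 0 < 1 / 2 - 1 / δ := by
    rw [sub_pos]; exact one_div_lt_one_div_of_lt two_pos hδ
  have hq1 : (1 : ℝ≥0∞) ≤ ENNReal.ofReal (2 * δ / (δ - 2)) := by
    rw [ENNReal.one_le_ofReal, one_le_div hδ2]; linarith
  have hsN : ∀ j : ℕ, s₀ ≤ 2 ^ j * s₀ := fun j =>
    le_mul_of_one_le_left hs₀.le (one_le_pow₀ one_le_two)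
  obtain ⟨N, hrN, hN⟩ := exists_two_pow_mul_near (r := r) hs₀
  set B := closedBall x₀ r with hB
  set V := μ B with hV
  set G := ∫⁻ y, u y ∂μ with hG
  set Φ := (∫⁻ y, φ y ^ 2 ∂μ) ^ (1 / 2 : ℝ) with hΦ
  have hV0 : V ≠ 0 := (measure_closedBall_pos μ x₀ hr).ne'
  have hVt : V ≠ ∞ := (hfin x₀ r).ne
  -- volume comparison between `B` and the small balls centred in `B`
  have hvol : ∀ j ≤ N, ∀ x ∈ B, V ≤ (D : ℝ≥0∞) ^ (N + 1 - j) * μ (closedBall x (2 ^ j * s₀)) := by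
    intro j hj x hx
    refine le_trans (measure_mono ?_)
      (measure_closedBall_two_pow_mul_le hs₀.le hD (N + 1 - j) x (hsN j))
    rw [← mul_assoc, ← pow_add, Nat.sub_add_cancel (hj.trans N.le_succ), pow_succ']
    refine closedBall_subset_closedBall' ?_
    have := mem_closedBall'.1 hx
    linarith
  set T : ℕ → M → ℝ≥0∞ := fun j x => (ENNReal.ofReal (2 * (2 ^ j * s₀)) * L ^ (1 / 2 : ℝ)) *
    ballQuotient μ (l * (2 ^ j * s₀)) (2 ^ j * s₀) u x ^ (1 / 2 : ℝ) with hT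
  have hTm : ∀ j, Measurable (T j) := fun j =>
    ((measurable_ballQuotient hu _ _).pow_const _).const_mul _
  have htele : ∀ (n : ℕ) (x : M), ballQuotient μ s₀ s₀ φ x ≤
      (∑ j ∈ Finset.range n, T j) x + ballQuotient μ (2 ^ n * s₀) (2 ^ n * s₀) φ x := by
    intro n x
    induction n with
    | zero => simp
    | succ n ih =>
      refine ih.trans ?_
      rw [Finset.sum_range_succ, Pi.add_apply, add_assoc]
      gcongr
      refine (hstep x _ (hsN n)).trans_eq ?_
      rw [add_comm, ENNReal.mul_rpow_of_nonneg _ _ (by norm_num), ← mul_assoc, pow_succ',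
        mul_assoc 2]
  have hlast := eLpNorm_ballQuotient_le_of_support isClosed_closedBall.measurableSet hV0 hVt hδ
    (fun x hx => by simpa using hvol N le_rfl x hx) hφ hsupp
  have hterm : ∀ j ∈ Finset.range N, eLpNorm (T j) (ENNReal.ofReal (2 * δ / (δ - 2)))
      (μ.restrict B) ≤ ENNReal.ofReal (2 * (2 ^ j * s₀) * (3 / 2) ^ (N + 1 - j)) *
        (L ^ (1 / 2 : ℝ) * K ^ (1 / 2 - 1 / δ) * (V ^ (1 / δ))⁻¹ * G ^ (1 / 2 : ℝ)) := by
    intro j hj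
    refine (eLpNorm_sqrt_ballQuotient_le isClosed_closedBall.measurableSet hV0 hVt
      (by positivity) (by positivity) hδ hfin hDδ (hvol j (Finset.mem_range.1 hj).le)
      (hK _ (hsN j)) hu _).trans_eq ?_
    rw [ENNReal.ofReal_mul (p := 2 * (2 ^ j * s₀)) (by positivity),
      ENNReal.ofReal_pow (p := 3 / 2) (by norm_num)]
    ring
  have hsum : ∑ j ∈ Finset.range N, ENNReal.ofReal (2 * (2 ^ j * s₀) * (3 / 2) ^ (N + 1 - j)) ≤
      ENNReal.ofReal (18 * r) := by
    rw [← ENNReal.ofReal_sum_of_nonneg fun j _ => by positivity]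
    refine ENNReal.ofReal_le_ofReal ?_
    have h1 : ∀ j ∈ Finset.range N, 2 * (2 ^ j * s₀) * (3 / 2 : ℝ) ^ (N + 1 - j) =
        3 * s₀ * (2 ^ j * (3 / 2) ^ (N - j)) := by
      intro j hj
      rw [Nat.succ_sub (Finset.mem_range.1 hj).le, pow_succ]
      ring
    rw [Finset.sum_congr rfl h1, ← Finset.mul_sum, sum_two_pow_mul_three_half_pow]
    rcases hN with rfl | hN
    · simpa using hr.le
    · have : 0 < s₀ * (3 / 2 : ℝ) ^ N := by positivity
      nlinarith
  have hmono : eLpNorm (ballQuotient μ s₀ s₀ φ) (ENNReal.ofReal (2 * δ / (δ - 2)))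
      (μ.restrict B) ≤ eLpNorm ((∑ j ∈ Finset.range N, T j) +
        ballQuotient μ (2 ^ N * s₀) (2 ^ N * s₀) φ) (ENNReal.ofReal (2 * δ / (δ - 2)))
          (μ.restrict B) :=
    eLpNorm_mono_enorm fun x => by
      rw [enorm_eq_self, enorm_eq_self, Pi.add_apply]
      exact htele N x
  have hadd := eLpNorm_add_le (μ := μ.restrict B) (f := ∑ j ∈ Finset.range N, T j)
    (g := ballQuotient μ (2 ^ N * s₀) (2 ^ N * s₀) φ)
    (Finset.aestronglyMeasurable_sum _ fun j _ => (hTm j).aestronglyMeasurable)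
    (measurable_ballQuotient hφ _ _).aestronglyMeasurable hq1
  have hsumT : eLpNorm (∑ j ∈ Finset.range N, T j) (ENNReal.ofReal (2 * δ / (δ - 2)))
      (μ.restrict B) ≤ ENNReal.ofReal (18 * r) *
        (L ^ (1 / 2 : ℝ) * K ^ (1 / 2 - 1 / δ) * (V ^ (1 / δ))⁻¹ * G ^ (1 / 2 : ℝ)) := by
    refine (eLpNorm_sum_le (fun j _ => (hTm j).aestronglyMeasurable) hq1).trans ?_
    refine (Finset.sum_le_sum hterm).trans ?_
    rw [← Finset.sum_mul]
    exact mul_le_mul_left hsum _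
  refine hmono.trans (hadd.trans ((add_le_add hsumT hlast).trans ?_))
  calc ENNReal.ofReal (18 * r) *
          (L ^ (1 / 2 : ℝ) * K ^ (1 / 2 - 1 / δ) * (V ^ (1 / δ))⁻¹ * G ^ (1 / 2 : ℝ)) +
          D * (V ^ (1 / δ))⁻¹ * Φ
      = (18 * L ^ (1 / 2 : ℝ) * K ^ (1 / 2 - 1 / δ) : ℝ≥0) * (V ^ (1 / δ))⁻¹ *
          (ENNReal.ofReal r * G ^ (1 / 2 : ℝ)) + D * (V ^ (1 / δ))⁻¹ * Φ := by
        rw [ENNReal.ofReal_mul (by norm_num), ENNReal.coe_mul, ENNReal.coe_mul,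
          ENNReal.coe_rpow_of_nonneg _ (by norm_num), ENNReal.coe_rpow_of_nonneg _ hδh.le]
        norm_num
        ring
    _ ≤ _ := by
        rw [mul_add]
        gcongr
        · exact le_self_add
        · exact le_add_self

end Dyadic

/-! ### The Sobolev inequality -/

theorem exists_two_lt_rpow_one_div_le (D : ℝ≥0) :
    ∃ δ : ℝ, 2 < δ ∧ (D : ℝ≥0∞) ^ (1 / δ) ≤ ENNReal.ofReal (3 / 2) := by
  obtain ⟨n, hn⟩ := pow_unbounded_of_one_lt (D : ℝ) (by norm_num : (1 : ℝ) < 3 / 2)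
  have hn' : (D : ℝ) ≤ (3 / 2) ^ (n + 3) :=
    hn.le.trans (pow_le_pow_right₀ (by norm_num) (by omega))
  have h3 : (2 : ℝ) < ((n + 3 : ℕ) : ℝ) := by exact_mod_cast (by omega : 2 < n + 3)
  refine ⟨((n + 3 : ℕ) : ℝ), h3, ?_⟩
  have h1 : (D : ℝ≥0∞) ≤ ENNReal.ofReal (3 / 2) ^ ((n + 3 : ℕ) : ℝ) := by
    rw [ENNReal.rpow_natCast, ← ENNReal.ofReal_pow (by norm_num), ← ENNReal.ofReal_coe_nnreal]
    exact ENNReal.ofReal_le_ofReal hn'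
  calc (D : ℝ≥0∞) ^ (1 / ((n + 3 : ℕ) : ℝ))
      ≤ (ENNReal.ofReal (3 / 2) ^ ((n + 3 : ℕ) : ℝ)) ^ (1 / ((n + 3 : ℕ) : ℝ)) := by gcongr
    _ = ENNReal.ofReal (3 / 2) := by
      rw [← ENNReal.rpow_mul, mul_one_div_cancel (by positivity), ENNReal.rpow_one]

/-- The Sobolev inequality in terms of extended nonnegative numbers, before squaring. -/
theorem exists_eLpNorm_restrictedOp_le {M : Type*} [MetricSpace M] [LocallyCompactSpace M]
    [MeasurableSpace M] [BorelSpace M] (μ : Measure M) [μ.Regular] [μ.IsOpenPosMeasure]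
    (hloc : VolumeDoublingLoc μ) (hinf : VolumeDoublingInfty μ)
    (h h' : ℝ) (hP : PoincareAtScale μ h)
    (κ : Kernel M M) (p : M → M → ℝ≥0) (hp : IsCompatible μ h h' κ p) :
    ∃ (δ : ℝ) (C : ℝ≥0), 2 < δ ∧ ∀ (r : ℝ), 0 < r → ∀ (x : M) (f : M → ℝ),
      MemLp f 2 (μ.restrict (closedBall x r)) →
        μ (closedBall x r) < ∞ ∧
        AEStronglyMeasurable (restrictedOp μ p (closedBall x r) f)
          (μ.restrict (closedBall x r)) ∧
        0 ≤ restrictedForm μ p (closedBall x r) f ∧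
        eLpNorm (restrictedOp μ p (closedBall x r) f) (ENNReal.ofReal (2 * δ / (δ - 2)))
            (μ.restrict (closedBall x r)) ≤
          C * (μ (closedBall x r) ^ (1 / δ))⁻¹ *
            (ENNReal.ofReal r *
              (ENNReal.ofReal (restrictedForm μ p (closedBall x r) f)) ^ (1 / 2 : ℝ) +
                eLpNorm f 2 (μ.restrict (closedBall x r))) := by
  have hfin : ∀ (x : M) (r : ℝ), μ (closedBall x r) < ∞ := hloc.measure_closedBall_lt_top
  have : SecondCountableTopology M := secondCountableTopology_of_measure_closedBall_lt_top hfin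
  have := hp.isMarkov
  obtain ⟨c₁, C₁, hc₁, -, htwo⟩ := hp.two_sided
  obtain ⟨CP, C₂, rP, -, hC₂, -, hPoin⟩ := hP
  obtain ⟨rD, D, -, -, hD⟩ := hinf
  have hh' : 0 < h' := hp.scale_pos.trans_le hp.scale_le
  -- above the scale `s₀`, both large-scale hypotheses apply
  set s₀ : ℝ := max h' (max rP rD) with hs₀def
  have hs₀ : 0 < s₀ := hh'.trans_le (le_max_left _ _)
  have hrP : rP ≤ s₀ := (le_max_left _ _).trans (le_max_right _ _)
  have hrD : rD ≤ s₀ := (le_max_right _ _).trans (le_max_right _ _)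
  have hDs : ∀ (x : M) (s : ℝ), s₀ ≤ s →
      μ (closedBall x (2 * s)) ≤ D * μ (closedBall x s) := fun x s hs => hD x s (hrD.trans hs)
  obtain ⟨δ, hδ, hDδ⟩ := exists_two_lt_rpow_one_div_le D
  obtain ⟨A, hA⟩ := hloc.exists_measure_closedBall_le hh' s₀
  have hl : 0 < C₂ * 2 := by linarith
  obtain ⟨k, hk⟩ := pow_unbounded_of_one_lt (2 * (C₂ * 2)) one_lt_two
  have hK : ∀ s : ℝ, s₀ ≤ s → ∀ x y : M, dist x y ≤ C₂ * 2 * s →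
      μ (closedBall y (C₂ * 2 * s)) ≤ (D ^ k : ℝ≥0) * μ (closedBall x s) := by
    intro s hs x y hxy
    rw [ENNReal.coe_pow]
    refine le_trans (measure_mono (closedBall_subset_closedBall' ?_))
      (measure_closedBall_two_pow_mul_le hs₀.le hDs k x hs)
    rw [dist_comm]
    have : 2 * (C₂ * 2) * s ≤ 2 ^ k * s := by gcongr; exact hs₀.le.trans hs
    linarith
  set K₁ : ℝ≥0 := 18 * (D * CP) ^ (1 / 2 : ℝ) * (D ^ k) ^ (1 / 2 - 1 / δ) + D with hK₁
  set K₂ : ℝ≥0 := max ((c₁⁻¹ * 2) ^ (1 / 2 : ℝ)) 1 with hK₂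
  refine ⟨δ, C₁ * A * K₁ * K₂, hδ, fun r hr x₀ f hf => ?_⟩
  have hBm : MeasurableSet (closedBall x₀ r) := isClosed_closedBall.measurableSet
  set B := closedBall x₀ r with hB
  -- `F` is a measurable representative of the extension of `f` by zero
  obtain ⟨g, hg, hfg⟩ := hf.1
  set F : M → ℝ := B.indicator g with hF
  have hFm : Measurable F := hg.measurable.indicator hBm
  have hF2 : MemLp F 2 μ := (memLp_indicator_iff_restrict hBm).2 (hf.ae_eq hfg)
  have hop : ∀ x, restrictedOp μ p B f x = ∫ y, F y ∂(κ x) := hp.restrictedOp_eq_integral hBm hfg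
  have hform := hp.restrictedForm_eq_integral hBm hfg
  obtain ⟨hen, hnn⟩ := hp.symmetric.lintegral_sub_sq hFm hF2
  rw [← hF] at hform
  rw [← hform] at hen hnn
  have hnorm : (∫⁻ y, ‖F y‖ₑ ^ 2 ∂μ) ^ (1 / 2 : ℝ) = eLpNorm f 2 (μ.restrict B) := by
    rw [eLpNorm_congr_ae hfg, ← eLpNorm_indicator_eq_eLpNorm_restrict hBm,
      eLpNorm_eq_lintegral_rpow_enorm_toReal two_ne_zero ENNReal.ofNat_ne_top]
    simp only [ENNReal.toReal_ofNat, ENNReal.rpow_two]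
    rfl
  have hgrad : ∫⁻ x, gradLength μ h F x ^ 2 ∂μ ≤
      (c₁⁻¹ * 2 : ℝ≥0) * ENNReal.ofReal (restrictedForm μ p B f) := by
    refine (lintegral_gradLength_sq_le hp hc₁ (fun x => (htwo x).mono fun y hy => hy.1)
      hFm).trans_eq ?_
    rw [hen, ENNReal.ofReal_mul zero_le_two, ENNReal.coe_mul, mul_assoc]
    norm_num
  have hpt : ∀ x, ‖restrictedOp μ p B f x‖ₑ ≤
      (C₁ * A : ℝ≥0) * ballQuotient μ s₀ s₀ (‖F ·‖ₑ) x := by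
    intro x
    rw [hop, ENNReal.coe_mul, mul_assoc]
    refine (enorm_integral_kernel_le hp (fun x => (htwo x).mono fun y hy => hy.2) hFm x).trans ?_
    gcongr
    have h0 := (measure_closedBall_pos μ x hs₀).ne'
    refine ENNReal.div_le_of_le_mul ?_
    calc ∫⁻ y in closedBall x h', ‖F y‖ₑ ∂μ ≤ ∫⁻ y in closedBall x s₀, ‖F y‖ₑ ∂μ :=
          lintegral_mono_set (closedBall_subset_closedBall (le_max_left _ _))
      _ = ballQuotient μ s₀ s₀ (‖F ·‖ₑ) x * μ (closedBall x s₀) :=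
          (ENNReal.div_mul_cancel h0 (hfin x s₀).ne).symm
      _ ≤ ballQuotient μ s₀ s₀ (‖F ·‖ₑ) x * (A * μ (closedBall x h')) := by gcongr; exact hA x
      _ = _ := by ring
  have hmain := eLpNorm_ballQuotient_le (μ := μ) (L := D * CP) hs₀ hl hδ hfin hDs hDδ hK
    (φ := (‖F ·‖ₑ)) (u := fun y => gradLength μ h F y ^ 2) hFm.enorm
    ((measurable_gradLength hFm h).pow_const 2) (by
      intro x s hs
      rw [mul_assoc C₂]
      exact ballQuotient_le_add_of_poincare hPoin hFm
        (measure_closedBall_pos μ x (hs₀.trans_le hs)).ne' (hDs x s hs) (hs₀.le.trans hs)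
        (by linarith) (hfin x _)) (x₀ := x₀) hr
      (fun y hy => by rw [hF, Set.indicator_of_notMem hy, enorm_zero])
  refine ⟨hfin x₀ r, ?_, hnn, ?_⟩
  · have : restrictedOp μ p B f = fun x => ∫ y, F y ∂(κ x) := funext hop
    rw [this]
    exact hFm.stronglyMeasurable.integral_kernel.aestronglyMeasurable
  have hconst : eLpNorm (restrictedOp μ p B f) (ENNReal.ofReal (2 * δ / (δ - 2)))
      (μ.restrict B) ≤ (C₁ * A : ℝ≥0) * eLpNorm (ballQuotient μ s₀ s₀ (‖F ·‖ₑ))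
        (ENNReal.ofReal (2 * δ / (δ - 2))) (μ.restrict B) :=
    eLpNorm_le_nnreal_smul_eLpNorm_of_ae_le_mul' (.of_forall fun x => hpt x) _
  have hsum : ENNReal.ofReal r * (∫⁻ y, gradLength μ h F y ^ 2 ∂μ) ^ (1 / 2 : ℝ) +
      (∫⁻ y, ‖F y‖ₑ ^ 2 ∂μ) ^ (1 / 2 : ℝ) ≤
      K₂ * (ENNReal.ofReal r * (ENNReal.ofReal (restrictedForm μ p B f)) ^ (1 / 2 : ℝ) +
        eLpNorm f 2 (μ.restrict B)) := by
    have hA1 : (((c₁⁻¹ * 2) ^ (1 / 2 : ℝ) : ℝ≥0) : ℝ≥0∞) ≤ K₂ :=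
      ENNReal.coe_le_coe.2 (le_max_left _ _)
    have hA2 : (1 : ℝ≥0∞) ≤ K₂ := by exact_mod_cast le_max_right _ _
    have hA3 : (∫⁻ y, gradLength μ h F y ^ 2 ∂μ) ^ (1 / 2 : ℝ) ≤
        K₂ * (ENNReal.ofReal (restrictedForm μ p B f)) ^ (1 / 2 : ℝ) := by
      refine (ENNReal.rpow_le_rpow hgrad (by norm_num)).trans ?_
      rw [ENNReal.mul_rpow_of_nonneg _ _ (by norm_num),
        ← ENNReal.coe_rpow_of_nonneg _ (by norm_num)]
      gcongr
    rw [mul_add, hnorm]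
    refine add_le_add ?_ (le_mul_of_one_le_left' hA2)
    rw [mul_left_comm]
    gcongr
  calc eLpNorm (restrictedOp μ p B f) (ENNReal.ofReal (2 * δ / (δ - 2))) (μ.restrict B)
      ≤ (C₁ * A : ℝ≥0) * (K₁ * (μ B ^ (1 / δ))⁻¹ *
        (K₂ * (ENNReal.ofReal r * (ENNReal.ofReal (restrictedForm μ p B f)) ^ (1 / 2 : ℝ) +
          eLpNorm f 2 (μ.restrict B)))) := by
        refine hconst.trans ?_
        gcongr
        refine hmain.trans ?_
        rw [← hK₁]
        gcongr
    _ = _ := by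
        rw [ENNReal.coe_mul (C₁ * A * K₁), ENNReal.coe_mul (C₁ * A)]
        ring

theorem mainTheorem4 {M : Type*} [MetricSpace M] [LocallyCompactSpace M]
    [MeasurableSpace M] [BorelSpace M]
    (μ : Measure M) [μ.Regular] [μ.IsOpenPosMeasure]
    (b : ℝ) (hb : 0 < b) (hgeo : IsQuasiGeodesic M b)
    (hloc : VolumeDoublingLoc μ) (hinf : VolumeDoublingInfty μ)
    (h h' : ℝ) (hP : PoincareAtScale μ h)
    (κ : Kernel M M) (p : M → M → ℝ≥0) (hp : IsCompatible μ h h' κ p) :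
    ∃ δ CS : ℝ, 2 < δ ∧ 0 < CS ∧
      ∀ (r : ℝ), 0 < r → ∀ (x : M) (f : M → ℝ),
        MemLp f 2 (μ.restrict (closedBall x r)) →
          MemLp (restrictedOp μ p (closedBall x r) f) (ENNReal.ofReal (2 * δ / (δ - 2)))
              (μ.restrict (closedBall x r)) ∧
            (eLpNorm (restrictedOp μ p (closedBall x r) f) (ENNReal.ofReal (2 * δ / (δ - 2)))
                (μ.restrict (closedBall x r))).toReal ^ 2 ≤
              CS * r ^ 2 / μ.real (closedBall x r) ^ (2 / δ) *
                (restrictedForm μ p (closedBall x r) f +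
                  (r ^ 2)⁻¹ * (eLpNorm f 2 (μ.restrict (closedBall x r))).toReal ^ 2) := by
  obtain ⟨δ, C, hδ, hC⟩ := exists_eLpNorm_restrictedOp_le μ hloc hinf h h' hP κ p hp
  refine ⟨δ, 2 * C ^ 2 + 1, hδ, by positivity, fun r hr x f hf => ?_⟩
  obtain ⟨hfin, hmeas, hnn, hle⟩ := hC r hr x f hf
  set E := restrictedForm μ p (closedBall x r) f with hE
  set n := eLpNorm f 2 (μ.restrict (closedBall x r)) with hn
  have hV0 : μ (closedBall x r) ≠ 0 := (measure_closedBall_pos μ x hr).ne'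
  have hnt : n ≠ ∞ := hf.2.ne
  have hVp : (μ (closedBall x r) ^ (1 / δ))⁻¹ ≠ ∞ := by
    rw [ENNReal.inv_ne_top]
    exact (ENNReal.rpow_pos (pos_iff_ne_zero.2 hV0) hfin.ne).ne'
  have hEt : (ENNReal.ofReal E) ^ (1 / 2 : ℝ) ≠ ∞ :=
    ENNReal.rpow_ne_top_of_nonneg (by norm_num) ENNReal.ofReal_ne_top
  have hRt : ENNReal.ofReal r * (ENNReal.ofReal E) ^ (1 / 2 : ℝ) ≠ ∞ :=
    ENNReal.mul_ne_top ENNReal.ofReal_ne_top hEt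
  have htop := ENNReal.mul_ne_top (ENNReal.mul_ne_top (ENNReal.coe_ne_top (r := C)) hVp)
    (ENNReal.add_ne_top.2 ⟨hRt, hnt⟩)
  refine ⟨⟨hmeas, hle.trans_lt htop.lt_top⟩, ?_⟩
  have hreal := ENNReal.toReal_mono htop hle
  rw [ENNReal.toReal_mul, ENNReal.toReal_mul, ENNReal.toReal_add hRt hnt, ENNReal.toReal_mul,
    ENNReal.toReal_inv, ← ENNReal.toReal_rpow, ← ENNReal.toReal_rpow, ENNReal.toReal_ofReal hr.le,
    ENNReal.toReal_ofReal hnn, ENNReal.coe_toReal, ← Real.sqrt_eq_rpow, ← measureReal_def] at hreal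
  have hv : 0 < μ.real (closedBall x r) := ENNReal.toReal_pos hV0 hfin.ne
  have hv2 : μ.real (closedBall x r) ^ (2 / δ) = (μ.real (closedBall x r) ^ (1 / δ)) ^ 2 := by
    rw [← Real.rpow_natCast, ← Real.rpow_mul hv.le]
    congr 1
    push_cast
    ring
  set w := μ.real (closedBall x r) ^ (1 / δ) with hw
  have hw0 : 0 < w := Real.rpow_pos_of_pos hv _
  rw [hv2]
  refine (pow_le_pow_left₀ ENNReal.toReal_nonneg hreal 2).trans ?_
  have hsq : (r * √E + n.toReal) ^ 2 ≤ 2 * (r ^ 2 * E + n.toReal ^ 2) := by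
    have h1 : √E ^ 2 = E := Real.sq_sqrt hnn
    nlinarith [sq_nonneg (r * √E - n.toReal)]
  have hnonneg : 0 ≤ r ^ 2 * E + n.toReal ^ 2 := by positivity
  calc (C * w⁻¹ * (r * √E + n.toReal)) ^ 2
      = C ^ 2 * (w ^ 2)⁻¹ * (r * √E + n.toReal) ^ 2 := by
        rw [mul_pow, mul_pow, inv_pow]
    _ ≤ C ^ 2 * (w ^ 2)⁻¹ * (2 * (r ^ 2 * E + n.toReal ^ 2)) := by gcongr
    _ = 2 * C ^ 2 * (w ^ 2)⁻¹ * (r ^ 2 * E + n.toReal ^ 2) := by ring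
    _ ≤ (2 * C ^ 2 + 1) * (w ^ 2)⁻¹ * (r ^ 2 * E + n.toReal ^ 2) := by
        gcongr
        linarith
    _ = _ := by
        field_simp
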